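/- Let $X=\mathbb P(T\mathbb P^2(\mathbb C))=\{(z,d)\in\mathbb P^2\times\check{\mathbb P}^2 : z\in d\}$, with projection $p(z,d)=z$. In the charts $(x,y,\lambda)$ of $X$, where $(x,y)$ are affine coordinates of $z$ and $\lambda$ is the slope of the line $d$, the complex contact structure is $\mathcal P=\ker(dy-\lambda\,dx)$. **Definitions.** * A *smooth submanifold* is an embedded (locally closed) real submanifold. A *real subvariety of class $\mathcal C^\mu$* is a subset whose smooth points are dense in it (a smooth point of dimension $d$ is a point near which the subset is a $\mathcal C^\mu$ smooth submanifold of dimension $d$); it is *of dimension $d$* if its smooth points of dimension $d$ are dense in it. * A *stratification* of class $\mathcal C^\mu$ of $Y$ is a decomposition of $Y$ into disjoint $\mathcal C^\mu$ smooth submanifolds $Y_i$ (the strata), each of some dimension $\dim Y_i$, such that every $y\in Y$ has a neighbourhood meeting only finitely many strata, and such that for $i\ne j$, $Y_i\cap\overline{Y_j}\neq\emptyset$ implies $\dim Y_i<\dim Y_j$; one then writes $Y_i<Y_j$. * The stratification *satisfies (C)* if for all strata $Y_i<Y_j$ and all sequences $y_n\in Y_j$ converging to some $y_\infty\in Y_i$,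 the tangent spaces $T_{y_n}Y_j$ converge and their limit contains $T_{y_\infty}Y_i$. * A real subvariety $S\subset X$ of class $\mathcal C^1$ and of dimension 2 or 3 is *semi-Legendrian* if $\dim_{\mathbb R}(\mathcal P_w\cap T_wS)\ge 2$ at each of its smooth points $w$. * For a smooth real submanifold $N\subset\mathbb P^2(\mathbb C)$ of class $\mathcal C^1$, $p^*N$ is the set of $(z,d)\in X$ with $z\in N$ and $T_zd+T_zN\neq T_z\mathbb P^2(\mathbb C)$. For a stratified $N=\bigcup_j N_j$, one sets $p^*N=\bigcup_j p^*N_j$ (this depends on the stratification). **Theorem.** Let $M\subset X$ be a real subvariety of dimension 3 and of class $\mathcal C^2$, and suppose that $N:=p(M)$ is a real subvariety of $\mathbb P^2(\mathbb C)$ of class $\mathcal C^r$ for some $r\ge 1$. Suppose that $M$ has a stratification $M=\bigcup_i M_i$ of class $\mathcal C^2$ whose strata of dimension 3 are semi-Legendrian, and that $N$ has a stratification $N=\bigcup_j N_j$ of class $\mathcal C^r$ satisfying (C). Suppose moreover that for every $i$ there is a $j$ such that $p(M_i)\subset N_j$ and $p|_{M_i}:M_i\to N_j$ is a submersion. Then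 $$M\subset p^*(p(M))=\bigcup_j p^*N_j .$$ -/

import Mathlib

open Set Filter Topology
open scoped LinearAlgebra.Projectivization

noncomputable section

namespace SemiLegendrian

/-! ### Real submanifolds of a real vector space -/

section Local

variable {E : Type*} [NormedAddCommGroup E] [NormedSpace ℝ E]

/-- Near `x`, the set `S` is a (locally closed, embedded) real submanifold of dimension `d` and
class `C^r`: some `C^r` diffeomorphism between open subsets of `E`, defined near `x`, carries `S`
onto a linear subspace of dimension `d`. -/
def IsSmoothAt (r : WithTop ℕ∞) (d : ℕ) (S : Set E) (x : E) : Prop :=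
  ∃ (Φ : OpenPartialHomeomorph E E) (V : Submodule ℝ E),
    Module.finrank ℝ V = d ∧ x ∈ Φ.source ∧
    ContDiffOn ℝ r Φ Φ.source ∧ ContDiffOn ℝ r Φ.symm Φ.target ∧
    ∀ y ∈ Φ.source, y ∈ S ↔ Φ y ∈ V

/-- The tangent space at `x` of a subset `S` of `E`: the span of the tangent cone of `S` at `x`.
For a `C^1` submanifold the tangent cone already is the tangent space. -/
def tangent (S : Set E) (x : E) : Submodule ℝ E :=
  Submodule.span ℝ (tangentConeAt ℝ S x)

/-- Convergence of a sequence of linear subspaces in the Grassmannian (with its topology of a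
quotient of the space of frames): suitable bases of the `V n` converge to a basis of `L`. -/
def SubspaceTendsto (V : ℕ → Submodule ℝ E) (L : Submodule ℝ E) : Prop :=
  ∃ (d : ℕ) (b : ℕ → Fin d → E) (c : Fin d → E),
    (∀ n, LinearIndependent ℝ (b n) ∧ Submodule.span ℝ (range (b n)) = V n) ∧
    LinearIndependent ℝ c ∧ Submodule.span ℝ (range c) = L ∧
    Tendsto b atTop (𝓝 c)

end Local

/-! ### Real submanifolds, subvarieties and stratifications in a manifold

The manifold `X` is given by a topology and by a family `ψ` of parametrizations `ψ σ : E → X`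
(the inverses of the charts of an atlas, each chart being onto `E`). -/

section Global

variable {E : Type*} [NormedAddCommGroup E] [NormedSpace ℝ E]
variable {X : Type*} [TopologicalSpace X] {K : Type*}

/-- `S` is near its point `w` a real submanifold of dimension `d` and class `C^r`
(`w` is a smooth point of `S`). -/
def IsSmoothPoint (ψ : K → E → X) (r : WithTop ℕ∞) (d : ℕ) (S : Set X) (w : X) : Prop :=
  w ∈ S ∧ ∀ σ u, ψ σ u = w → IsSmoothAt r d (ψ σ ⁻¹' S) u

/-- `S` is a smooth (non-singular) real submanifold of dimension `d` and class `C^r`. -/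
def IsSubmanifold (ψ : K → E → X) (r : WithTop ℕ∞) (d : ℕ) (S : Set X) : Prop :=
  ∀ w ∈ S, IsSmoothPoint ψ r d S w

/-- `S` is a possibly singular real subvariety of class `C^r`: its smooth points
(of whatever dimension) are dense in it. -/
def IsSubvariety (ψ : K → E → X) (r : WithTop ℕ∞) (S : Set X) : Prop :=
  S ⊆ closure {w | ∃ d, IsSmoothPoint ψ r d S w}

/-- `S` is a possibly singular real subvariety of class `C^r` and of (pure) dimension `d`: its
smooth points of dimension `d` are dense in it. -/
def IsSubvarietyOfDim (ψ : K → E → X) (r : WithTop ℕ∞) (d : ℕ) (S : Set X) : Prop :=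
  S ⊆ closure {w | IsSmoothPoint ψ r d S w}

/-- The sets `Y i`, of dimension `dim i`, are the strata of a stratification of class `C^r`
of `Y`. -/
structure IsStratification {I : Type*} (ψ : K → E → X) (r : WithTop ℕ∞) (Y : Set X)
    (strata : I → Set X) (dim : I → ℕ) : Prop where
  iUnion_eq : ⋃ i, strata i = Y
  disjoint : Pairwise fun i j => Disjoint (strata i) (strata j)
  submanifold : ∀ i, IsSubmanifold ψ r (dim i) (strata i)
  locallyFinite : ∀ y ∈ Y, ∃ U ∈ 𝓝 y, {i | (strata i ∩ U).Nonempty}.Finite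
  frontier : ∀ i j, i ≠ j → (strata i ∩ closure (strata j)).Nonempty → dim i < dim j

/-- Condition (C): whenever `Y_i < Y_j` (that is, `i ≠ j` and `Y_i` meets the closure of `Y_j`)
and points `y_n ∈ Y_j` converge to `y_∞ ∈ Y_i`, the tangent spaces of `Y_j` at `y_n` converge and
the limit contains the tangent space of `Y_i` at `y_∞`. Points and tangent spaces are read in the
charts around `y_∞`. (A sequence as below exists only if `Y_i` meets the closure of `Y_j`.) -/
def ConditionC {I : Type*} (ψ : K → E → X) (strata : I → Set X) : Prop :=
  ∀ i j, i ≠ j → ∀ (σ : K) (u : ℕ → E) (v : E),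
    (∀ n, ψ σ (u n) ∈ strata j) → ψ σ v ∈ strata i → Tendsto u atTop (𝓝 v) →
    ∃ L, SubspaceTendsto (fun n => tangent (ψ σ ⁻¹' strata j) (u n)) L ∧
      tangent (ψ σ ⁻¹' strata i) v ≤ L

end Global

/-! ### The complex projective plane and its projectivized tangent bundle -/

/-- The complex projective plane `P²(ℂ)`. -/
abbrev P2 : Type := ℙ ℂ (Fin 3 → ℂ)

/-- The quotient topology. -/
instance : TopologicalSpace P2 :=
  TopologicalSpace.coinduced (Projectivization.mk' ℂ : {v : Fin 3 → ℂ // v ≠ 0} → P2)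
    inferInstance

/-- The projectivized tangent bundle of `P²(ℂ)`, as the space of pairs `(z, d)` of a point `z` and
a complex line `d` through `z`. The dual plane is identified with `P²(ℂ)`: the point `[a]` is the
line of equation `a₀ z₀ + a₁ z₁ + a₂ z₂ = 0`. The topology is induced by the product. -/
abbrev PTP2 : Type := {w : P2 × P2 // w.1.orthogonal w.2}

/-- The projection `p : P(TP²) → P²`. -/
def projP (w : PTP2) : P2 := w.1.1

theorem vec_ne_zero (σ : Equiv.Perm (Fin 3)) {t : Fin 3 → ℂ} (i : Fin 3) (h : t i ≠ 0) :
    t ∘ σ.symm ≠ 0 := fun h0 => h (by simpa using congrFun h0 (σ i))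

/-- The affine charts of `P²(ℂ)`: for a permutation `σ` of the homogeneous coordinates,
`(x, y)` is the point with `z_{σ 0} = 1`, `z_{σ 1} = x`, `z_{σ 2} = y`. -/
def planeParam (σ : Equiv.Perm (Fin 3)) (u : ℂ × ℂ) : P2 :=
  Projectivization.mk ℂ (![1, u.1, u.2] ∘ σ.symm) (vec_ne_zero σ 0 (by simp))

/-- The charts of `P(TP²)`: `(x, y, l)` is the point `(x, y)` of the affine chart `σ` of `P²(ℂ)`
with the complex line of slope `l = dy / dx` through it, which has the equation
`(l x - y) z_{σ 0} - l z_{σ 1} + z_{σ 2} = 0`. Exchanging `σ 1` and `σ 2` exchanges `x` and `y`, so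
that vertical directions are covered too. -/
def flagParam (σ : Equiv.Perm (Fin 3)) (u : ℂ × ℂ × ℂ) : PTP2 :=
  ⟨(planeParam σ (u.1, u.2.1),
    Projectivization.mk ℂ (![u.2.2 * u.1 - u.2.1, -u.2.2, 1] ∘ σ.symm)
      (vec_ne_zero σ 2 (by simp))), by
    rw [planeParam, Projectivization.orthogonal_mk, comp_equiv_symm_dotProduct]
    simp [dotProduct, Fin.sum_univ_three, Function.comp_def]
    ring⟩

/-- The projection `p` in the charts: `(x, y, l) ↦ (x, y)`. -/
def projLin : (ℂ × ℂ × ℂ) →ₗ[ℝ] (ℂ × ℂ) where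
  toFun u := (u.1, u.2.1)
  map_add' _ _ := rfl
  map_smul' _ _ := rfl

theorem projP_flagParam (σ : Equiv.Perm (Fin 3)) (u : ℂ × ℂ × ℂ) :
    projP (flagParam σ u) = planeParam σ (projLin u) := rfl

/-- The charts cover `P(TP²)`. -/
theorem exists_flagParam (w : PTP2) : ∃ σ u, flagParam σ u = w := by
  obtain ⟨⟨z, d⟩, h⟩ := w
  induction z using Projectivization.ind with | h v hv
  induction d using Projectivization.ind with | h a ha
  rw [Projectivization.orthogonal_mk] at h
  obtain ⟨σ, h0, h2⟩ : ∃ σ : Equiv.Perm (Fin 3), v (σ 0) ≠ 0 ∧ a (σ 2) ≠ 0 := by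
    obtain ⟨k, hk⟩ := Function.ne_iff.mp hv
    obtain ⟨l, hl, hal⟩ : ∃ l, l ≠ k ∧ a l ≠ 0 := by
      by_contra! h'
      rw [dotProduct, Finset.sum_eq_single k (fun l _ hl => by rw [h' l hl, mul_zero])
        (by simp)] at h
      have hk' : a k = 0 := (mul_eq_zero.mp h).resolve_left hk
      exact ha (funext fun l => if e : l = k then e ▸ hk' else h' l e)
    have key : ∀ k l : Fin 3, l ≠ k → ∃ σ : Equiv.Perm (Fin 3), σ 0 = k ∧ σ 2 = l := by decide
    obtain ⟨σ, rfl, rfl⟩ := key k l hl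
    exact ⟨σ, hk, hal⟩
  have hs : v (σ 0) * a (σ 0) + v (σ 1) * a (σ 1) + v (σ 2) * a (σ 2) = 0 := by
    rw [← h, dotProduct, ← Equiv.sum_comp σ, Fin.sum_univ_three]
  refine ⟨σ, (v (σ 1) / v (σ 0), v (σ 2) / v (σ 0), -a (σ 1) / a (σ 2)),
    Subtype.ext (Prod.ext ?_ ?_)⟩
  · refine (Projectivization.mk_eq_mk_iff' ℂ _ _ _ _).mpr ⟨(v (σ 0))⁻¹, ?_⟩
    rw [Equiv.eq_comp_symm]
    ext i
    fin_cases i <;> simp [h0, div_eq_inv_mul]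
  · refine (Projectivization.mk_eq_mk_iff' ℂ _ _ _ _).mpr ⟨(a (σ 2))⁻¹, ?_⟩
    rw [Equiv.eq_comp_symm]
    ext i
    fin_cases i
    · simp
      field_simp
      linear_combination hs
    · simp
      field_simp
    · simp [h2]

/-- The direction of the complex lines of slope `l` in `ℂ²`. -/
def slopeLine (l : ℂ) : Submodule ℝ (ℂ × ℂ) where
  carrier := {v | v.2 = l * v.1}
  add_mem' := by
    intro a b ha hb
    simp only [mem_ofPred_eq, Prod.fst_add, Prod.snd_add] at *
    rw [ha, hb, mul_add]
  zero_mem' := by simp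
  smul_mem' := by
    intro c a ha
    simp only [mem_ofPred_eq, Prod.smul_fst, Prod.smul_snd] at *
    rw [ha, mul_smul_comm]

/-- The contact plane at `u = (x, y, l)`: the kernel of `ω = dy - l dx`. -/
def contactPlane (u : ℂ × ℂ × ℂ) : Submodule ℝ (ℂ × ℂ × ℂ) :=
  (slopeLine u.2.2).comap projLin

/-- A real subvariety of `P(TP²)` of dimension `d ∈ {2, 3}` and class `C^1` is semi-legendrian if
at each of its smooth points its tangent space meets the contact plane in real dimension at
least 2. -/
def IsSemiLegendrian (d : ℕ) (S : Set PTP2) : Prop :=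
  (d = 2 ∨ d = 3) ∧ IsSubvarietyOfDim flagParam 1 d S ∧
  ∀ w, IsSmoothPoint flagParam 1 d S w → ∀ σ u, flagParam σ u = w →
    2 ≤ Module.finrank ℝ
      (contactPlane u ⊓ tangent (flagParam σ ⁻¹' S) u : Submodule ℝ (ℂ × ℂ × ℂ))

/-- The lift `p^*S` of a smooth real submanifold `S` of `P²(ℂ)`: the pairs `(z, D)` with `z ∈ S`
and `D` a complex line through `z` such that `D + T_z S` is not the whole tangent space at `z`. -/
def pStar (S : Set P2) : Set PTP2 :=
  {w | projP w ∈ S ∧ ∀ σ u, flagParam σ u = w →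
    slopeLine u.2.2 ⊔ tangent (planeParam σ ⁻¹' S) (projLin u) ≠ ⊤}

/-- `p` maps `S` into `T` and its restriction `S → T` is a submersion. -/
def IsSubmersionOn (S : Set PTP2) (T : Set P2) : Prop :=
  MapsTo projP S T ∧ ∀ σ u, flagParam σ u ∈ S →
    (tangent (flagParam σ ⁻¹' S) u).map projLin = tangent (planeParam σ ⁻¹' T) (projLin u)

end SemiLegendrian

end

open SemiLegendrian

noncomputable section

namespace SemiLegendrian

/-! ### Tangent spaces of straightened sets, and limits of subspaces. -/

section Local

variable {E : Type*} [NormedAddCommGroup E] [NormedSpace ℝ E]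

/-! Strata of dimension 3 are dense in `M`, so each point of `M` is a limit of points `u n` in one
such stratum `Ms i` (`IsStratification.exists_mem_closure`). At `u n` the tangent space has
dimension 3 and meets the contact plane in dimension at least 2, so its image in `ℂ²` modulo the
complex line has real dimension at most 1 and the line is not transverse to it
(`slopeLine_sup_map_ne_top`). By the submersion hypothesis this image is the tangent space of a
stratum `Ns j'`.

Non-transversality is a closed condition, since spanning is open
(`slopeLine_sup_ne_top_of_tendsto`). It therefore survives in the limit, where the tangent spaces of
`Ns j'` tend to a space containing that of the stratum `Ns j` through the limit point: by (C) if `j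
≠ j'`, and by continuity of the tangent spaces of a `C^1` submanifold if `j = j'`
(`IsStraightening.subspaceTendsto_tangent`). -/

theorem tangentConeAt_submodule_subset (V : Submodule ℝ E) (hV : IsClosed (V : Set E)) {x : E}
    (hx : x ∈ V) : tangentConeAt ℝ (V : Set E) x ⊆ V := by
  intro y hy
  obtain ⟨α, l, hl, c, d, -, hd, hcd⟩ := exists_fun_of_mem_tangentConeAt hy
  refine hV.mem_of_tendsto hcd (hd.mono fun n hn => V.smul_mem _ ?_)
  simpa using V.sub_mem hn hx

theorem subset_tangentConeAt_submodule (V : Submodule ℝ E) {x : E} (hx : x ∈ V) :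
    (V : Set E) ⊆ tangentConeAt ℝ (V : Set E) x := by
  intro y hy
  have := mem_tangentConeAt_of_segment_subset
    ((V.convex).segment_subset hx (V.add_mem hx hy))
  simpa using this

/-- A `C^1` straightening of a set onto a linear subspace. -/
structure IsStraightening (Φ : OpenPartialHomeomorph E E) (V : Submodule ℝ E) (S : Set E) :
    Prop where
  contDiffOn : ContDiffOn ℝ 1 Φ Φ.source
  contDiffOn_symm : ContDiffOn ℝ 1 Φ.symm Φ.target
  mem_iff : ∀ y ∈ Φ.source, y ∈ S ↔ Φ y ∈ V

namespace IsStraightening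

variable {Φ : OpenPartialHomeomorph E E} {V : Submodule ℝ E} {S : Set E}

theorem hasFDerivAt (h : IsStraightening Φ V S) {x : E} (hx : x ∈ Φ.source) :
    HasFDerivAt Φ (fderiv ℝ Φ x) x :=
  ((h.contDiffOn.contDiffAt (Φ.open_source.mem_nhds hx)).differentiableAt (by simp)).hasFDerivAt

theorem hasFDerivAt_symm (h : IsStraightening Φ V S) {y : E} (hy : y ∈ Φ.target) :
    HasFDerivAt Φ.symm (fderiv ℝ Φ.symm y) y :=
  ((h.contDiffOn_symm.contDiffAt (Φ.open_target.mem_nhds hy)).differentiableAt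
    (by simp)).hasFDerivAt

theorem fderiv_symm_fderiv (h : IsStraightening Φ V S) {x : E} (hx : x ∈ Φ.source) (v : E) :
    fderiv ℝ Φ.symm (Φ x) (fderiv ℝ Φ x v) = v := by
  have h1 := (h.hasFDerivAt_symm (Φ.map_source hx)).comp x (h.hasFDerivAt hx)
  have h2 : HasFDerivAt (Φ.symm ∘ Φ) (ContinuousLinearMap.id ℝ E) x :=
    (hasFDerivAt_id x).congr_of_eventuallyEq
      (by filter_upwards [Φ.open_source.mem_nhds hx] with y hy using Φ.left_inv hy)
  exact congrArg (fun f : E →L[ℝ] E => f v) (h1.unique h2)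

theorem fderiv_fderiv_symm (h : IsStraightening Φ V S) {x : E} (hx : x ∈ Φ.source) (v : E) :
    fderiv ℝ Φ x (fderiv ℝ Φ.symm (Φ x) v) = v := by
  have hy := Φ.map_source hx
  have h0 := h.hasFDerivAt hx
  have h1 := HasFDerivAt.comp (Φ x) (g := Φ) (g' := fderiv ℝ Φ x)
    (by rwa [Φ.left_inv hx]) (h.hasFDerivAt_symm hy)
  have h2 : HasFDerivAt (Φ ∘ Φ.symm) (ContinuousLinearMap.id ℝ E) (Φ x) :=
    (hasFDerivAt_id _).congr_of_eventuallyEq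
      (by filter_upwards [Φ.open_target.mem_nhds hy] with y hy using Φ.right_inv hy)
  exact congrArg (fun f : E →L[ℝ] E => f v) (h1.unique h2)

/-- Derivatives carry tangent cones to tangent cones, and the cone of a linear subspace is the
subspace itself. Applying this to `Φ` and to `Φ.symm` gives the two inclusions. -/
theorem tangent_eq [FiniteDimensional ℝ E] (h : IsStraightening Φ V S) {x : E}
    (hx : x ∈ Φ.source) (hxS : x ∈ S) :
    tangent S x = V.map (fderiv ℝ Φ.symm (Φ x) : E →ₗ[ℝ] E) := by
  have hxV : Φ x ∈ V := (h.mem_iff x hx).1 hxS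
  have hs := Φ.open_source.mem_nhds hx
  have ht := Φ.open_target.mem_nhds (Φ.map_source hx)
  apply le_antisymm
  · refine Submodule.span_le.2 fun v hv => ?_
    rw [← tangentConeAt_inter_nhds hs] at hv
    have h1 := (h.hasFDerivAt hx).hasFDerivWithinAt.mapsTo_tangent_cone hv
    have h2 : Φ '' (S ∩ Φ.source) ⊆ V := by
      rintro _ ⟨y, hy, rfl⟩
      exact (h.mem_iff y hy.2).1 hy.1
    exact ⟨_, tangentConeAt_submodule_subset V V.closed_of_finiteDimensional hxV
      (tangentConeAt_mono h2 h1), h.fderiv_symm_fderiv hx v⟩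
  · rintro _ ⟨v, hv, rfl⟩
    have h0 := subset_tangentConeAt_submodule V hxV hv
    rw [← tangentConeAt_inter_nhds ht] at h0
    have h1 := (h.hasFDerivAt_symm (Φ.map_source hx)).hasFDerivWithinAt.mapsTo_tangent_cone h0
    rw [Φ.left_inv hx] at h1
    refine Submodule.subset_span (tangentConeAt_mono ?_ h1)
    rintro _ ⟨y, hy, rfl⟩
    refine (h.mem_iff _ (Φ.map_target hy.2)).2 ?_
    rw [Φ.right_inv hy.2]
    exact hy.1

theorem fderiv_symm_injective (h : IsStraightening Φ V S) {x : E} (hx : x ∈ Φ.source) :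
    Function.Injective (fderiv ℝ Φ.symm (Φ x)) :=
  Function.LeftInverse.injective (h.fderiv_fderiv_symm hx)

/-- A fixed basis of `V`, pushed forward by the derivative of `Φ.symm`, is a frame of the tangent
space that varies continuously because `Φ.symm` is `C^1`. -/
theorem subspaceTendsto_tangent [FiniteDimensional ℝ E] (h : IsStraightening Φ V S)
    {u : ℕ → E} {v : E} (hu : ∀ n, u n ∈ Φ.source) (hv : v ∈ Φ.source) (huS : ∀ n, u n ∈ S)
    (hvS : v ∈ S) (huv : Tendsto u atTop (𝓝 v)) :
    SubspaceTendsto (fun n => tangent S (u n)) (tangent S v) := by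
  let e := Module.finBasis ℝ V
  have hli : ∀ y ∈ Φ.source,
      LinearIndependent ℝ (fun i => fderiv ℝ Φ.symm (Φ y) (e i : E)) := fun y hy =>
    ((e.linearIndependent.map' V.subtype V.ker_subtype).map'
      (fderiv ℝ Φ.symm (Φ y) : E →ₗ[ℝ] E)
      (LinearMap.ker_eq_bot.2 (h.fderiv_symm_injective hy)))
  have hsp : ∀ y ∈ Φ.source, y ∈ S →
      Submodule.span ℝ (range fun i => fderiv ℝ Φ.symm (Φ y) (e i : E)) = tangent S y := by
    intro y hy hyS
    rw [h.tangent_eq hy hyS]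
    have : V = Submodule.span ℝ (range fun i => (e i : E)) := by
      have := congrArg (Submodule.map V.subtype) e.span_eq
      rw [Submodule.map_span, ← range_comp, Submodule.map_top, Submodule.range_subtype] at this
      exact this.symm
    conv_rhs => rw [this]
    rw [Submodule.map_span, ← range_comp]
    rfl
  refine ⟨_, fun n i => fderiv ℝ Φ.symm (Φ (u n)) (e i), fun i => fderiv ℝ Φ.symm (Φ v) (e i),
    fun n => ⟨hli _ (hu n), hsp _ (hu n) (huS n)⟩, hli _ hv, hsp _ hv hvS, ?_⟩
  refine tendsto_pi_nhds.2 fun i => ?_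
  have hc : ContinuousAt (fderiv ℝ Φ.symm) (Φ v) :=
    (h.contDiffOn_symm.contDiffAt
      (Φ.open_target.mem_nhds (Φ.map_source hv))).continuousAt_fderiv (by simp)
  have hc' : Tendsto (fun n => fderiv ℝ Φ.symm (Φ (u n))) atTop (𝓝 (fderiv ℝ Φ.symm (Φ v))) :=
    hc.tendsto.comp ((Φ.continuousAt hv).tendsto.comp huv)
  exact ((ContinuousLinearMap.apply ℝ E (e i : E)).continuous.tendsto _).comp hc'

end IsStraightening

theorem IsSmoothAt.exists_isStraightening {r : WithTop ℕ∞} {d : ℕ} {S : Set E} {x : E}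
    (h : IsSmoothAt r d S x) (hr : 1 ≤ r) : ∃ (Φ : OpenPartialHomeomorph E E)
      (V : Submodule ℝ E), Module.finrank ℝ V = d ∧ x ∈ Φ.source ∧ IsStraightening Φ V S := by
  obtain ⟨Φ, V, hd, hx, h1, h2, h3⟩ := h
  exact ⟨Φ, V, hd, hx, h1.of_le hr, h2.of_le hr, h3⟩

theorem IsSmoothAt.of_le {r s : WithTop ℕ∞} {d : ℕ} {S : Set E} {x : E}
    (h : IsSmoothAt r d S x) (hs : s ≤ r) : IsSmoothAt s d S x := by
  obtain ⟨Φ, V, hd, hx, h1, h2, h3⟩ := h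
  exact ⟨Φ, V, hd, hx, h1.of_le hs, h2.of_le hs, h3⟩

theorem IsSmoothAt.eventually {r : WithTop ℕ∞} {d : ℕ} {S : Set E} {x : E}
    (h : IsSmoothAt r d S x) : ∀ᶠ y in 𝓝 x, IsSmoothAt r d S y := by
  obtain ⟨Φ, V, hd, hx, h⟩ := h
  filter_upwards [Φ.open_source.mem_nhds hx] with y hy using ⟨Φ, V, hd, hy, h⟩

theorem IsSmoothAt.finrank_tangent [FiniteDimensional ℝ E] {r : WithTop ℕ∞} {d : ℕ} {S : Set E}
    {x : E} (h : IsSmoothAt r d S x) (hr : 1 ≤ r) (hx : x ∈ S) :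
    Module.finrank ℝ (tangent S x) = d := by
  obtain ⟨Φ, V, hd, hxs, hΦ⟩ := h.exists_isStraightening hr
  rw [hΦ.tangent_eq hxs hx, ← hd]
  exact (Submodule.equivMapOfInjective (fderiv ℝ Φ.symm (Φ x) : E →ₗ[ℝ] E)
    (hΦ.fderiv_symm_injective hxs) V).finrank_eq.symm

theorem tangent_congr {S T : Set E} {x : E} (h : ∀ᶠ y in 𝓝 x, y ∈ S ↔ y ∈ T) :
    tangent S x = tangent T x := by
  rw [tangent, tangent, tangentConeAt_congr]
  exact nhdsWithin_eq_iff_eventuallyEq.2 (h.mono fun y hy => propext hy)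

/-- Spanning the whole space is an open condition on finite families. -/
theorem eventually_span_eq_top [FiniteDimensional ℝ E] {ι : Type*} [Finite ι]
    {b : ℕ → ι → E} {c : ι → E}
    (hb : Tendsto b atTop (𝓝 c)) (hc : Submodule.span ℝ (range c) = ⊤) :
    ∀ᶠ n in atTop, Submodule.span ℝ (range (b n)) = ⊤ := by
  -- Extract a basis from the limit family: independence is open, and as many independent vectors as
  -- the dimension span.
  obtain ⟨κ, a, ha, hspan, hli⟩ := exists_linearIndependent' ℝ c
  rw [hc] at hspan
  have : Finite κ := Finite.of_injective a ha
  have : Fintype κ := Fintype.ofFinite κ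
  have hcard : Fintype.card κ = Module.finrank ℝ E := by
    rw [← finrank_span_eq_card hli, hspan, finrank_top]
  have ht : Tendsto (fun n => b n ∘ a) atTop (𝓝 (c ∘ a)) :=
    tendsto_pi_nhds.2 fun i => (tendsto_pi_nhds.1 hb) (a i)
  filter_upwards [ht.eventually (isOpen_setOfPred_linearIndependent.mem_nhds hli)] with n hn
  have h1 : Submodule.span ℝ (range (b n ∘ a)) = ⊤ :=
    hn.span_eq_top_of_card_eq_finrank' hcard
  exact top_le_iff.1 (h1 ▸ Submodule.span_mono (range_comp_subset_range a (b n)))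

end Local

/-! ### Transversality to a complex line. -/

theorem slopeLine_eq_span (l : ℂ) :
    slopeLine l = Submodule.span ℝ (range ![((1 : ℂ), l), (Complex.I, l * Complex.I)]) := by
  apply le_antisymm
  · rintro ⟨x, y⟩ (h : y = l * x)
    rw [Matrix.range_cons, Matrix.range_cons, Matrix.range_empty, union_empty, singleton_union,
      Submodule.mem_span_pair]
    refine ⟨x.re, x.im, ?_⟩
    have hx : (x.re : ℂ) + x.im * Complex.I = x := Complex.re_add_im x
    ext1
    · simp
    · simp only [Prod.snd_add, Prod.smul_snd, Complex.real_smul, h]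
      linear_combination l * hx
  · refine Submodule.span_le.2 ?_
    rintro _ ⟨i, rfl⟩
    fin_cases i
    · exact (mul_one l).symm
    · rfl

/-- A real basis of the line depends continuously on its slope. Joined to the converging frames of
the `T n`, it gives converging generating families, so if the limit family spanned, so would the
families for large `n`. -/
theorem slopeLine_sup_ne_top_of_tendsto {l : ℕ → ℂ} {l₀ : ℂ} (hl : Tendsto l atTop (𝓝 l₀))
    {T : ℕ → Submodule ℝ (ℂ × ℂ)} {L : Submodule ℝ (ℂ × ℂ)} (hT : SubspaceTendsto T L)
    (h : ∀ n, slopeLine (l n) ⊔ T n ≠ ⊤) : slopeLine l₀ ⊔ L ≠ ⊤ := by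
  obtain ⟨d, b, c, hb, -, hc, hbc⟩ := hT
  let f : ℂ → Fin 2 → ℂ × ℂ := fun l => ![((1 : ℂ), l), (Complex.I, l * Complex.I)]
  have hf : Continuous f := by
    refine continuous_pi fun i => ?_
    fin_cases i
    · exact continuous_const.prodMk continuous_id
    · exact continuous_const.prodMk (continuous_id.mul continuous_const)
  have key : Tendsto (fun n => Sum.elim (f (l n)) (b n)) atTop (𝓝 (Sum.elim (f l₀) c)) := by
    refine tendsto_pi_nhds.2 ?_
    rintro (i | i)
    · exact tendsto_pi_nhds.1 ((hf.tendsto l₀).comp hl) i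
    · exact tendsto_pi_nhds.1 hbc i
  intro htop
  have := eventually_span_eq_top key
    (by rw [Sum.elim_range, Submodule.span_union, hc, ← slopeLine_eq_span, htop])
  obtain ⟨n, hn⟩ := this.exists
  rw [Sum.elim_range, Submodule.span_union, (hb n).2, ← slopeLine_eq_span] at hn
  exact h n hn

/-- A three-dimensional real subspace meeting the contact plane in dimension at least two
projects to a subspace that is not transverse to the complex line. -/
theorem slopeLine_sup_map_ne_top {u : ℂ × ℂ × ℂ} {T : Submodule ℝ (ℂ × ℂ × ℂ)}
    (hT : Module.finrank ℝ T = 3)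
    (h : 2 ≤ Module.finrank ℝ (contactPlane u ⊓ T : Submodule ℝ (ℂ × ℂ × ℂ))) :
    slopeLine u.2.2 ⊔ T.map projLin ≠ ⊤ := by
  intro htop
  -- The kernel of `f` is the intersection of `T` with the contact plane. Were `f` onto,
  -- rank-nullity would give `3 ≥ 2 + 2`, the quotient having real dimension at least 2.
  let f : T →ₗ[ℝ] (ℂ × ℂ) ⧸ slopeLine u.2.2 := (slopeLine u.2.2).mkQ ∘ₗ projLin ∘ₗ T.subtype
  have hrange : LinearMap.range f = ⊤ := by
    have : LinearMap.range f = (T.map projLin).map (slopeLine u.2.2).mkQ := by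
      simp only [f, LinearMap.range_comp, Submodule.range_subtype]
    rw [this, ← (Submodule.map_mkQ_eq_top _ _).2 htop]
  have hker : Module.finrank ℝ (LinearMap.ker f) =
      Module.finrank ℝ (contactPlane u ⊓ T : Submodule ℝ (ℂ × ℂ × ℂ)) := by
    have : contactPlane u ⊓ T = (LinearMap.ker f).map T.subtype := by
      have hk : LinearMap.ker f = (contactPlane u).comap T.subtype := by
        simp only [f, LinearMap.ker_comp, Submodule.ker_mkQ]
        rfl
      rw [hk, Submodule.map_comap_subtype, inf_comm]
    rw [this, Submodule.finrank_map_subtype_eq]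
  have h1 := f.finrank_range_add_finrank_ker
  rw [hrange, finrank_top, hker, hT] at h1
  have h2 := (slopeLine u.2.2).finrank_quotient_add_finrank
  have h3 : Module.finrank ℝ (ℂ × ℂ) = 4 := by
    rw [Module.finrank_prod, Complex.finrank_real_complex]
  have h4 : Module.finrank ℝ (slopeLine u.2.2) ≤ 2 := by
    rw [slopeLine_eq_span]
    exact finrank_range_le_card _
  omega

/-! ### The charts are continuous and open -/

/-- The ratio `z_i / z_j` of homogeneous coordinates. -/
def coordRatio (i j : Fin 3) : P2 → ℂ :=
  Projectivization.lift (fun v => v.1 i / v.1 j) (by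
    rintro ⟨a, ha⟩ ⟨b, hb⟩ t rfl
    have ht : t ≠ 0 := fun h => ha (by simp [h])
    exact mul_div_mul_left _ _ ht)

/-- The points of the projective plane whose `j`-th homogeneous coordinate does not vanish. -/
def affinePart (j : Fin 3) : Set P2 := {z | coordRatio j j z ≠ 0}

theorem mk_mem_affinePart {j : Fin 3} {v : Fin 3 → ℂ} (hv : v ≠ 0) :
    Projectivization.mk ℂ v hv ∈ affinePart j ↔ v j ≠ 0 := by
  -- Since division by zero gives zero, this quotient is 1 or 0.
  change v j / v j ≠ 0 ↔ _
  simp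

theorem isQuotientMap_mk' :
    IsQuotientMap (Projectivization.mk' ℂ : {v : Fin 3 → ℂ // v ≠ 0} → P2) :=
  ⟨⟨rfl⟩, fun z => by
    induction z using Projectivization.ind with | h v hv
    exact ⟨⟨v, hv⟩, rfl⟩⟩

theorem isOpen_affinePart (j : Fin 3) : IsOpen (affinePart j) := by
  rw [← isQuotientMap_mk'.isOpen_preimage]
  have : (Projectivization.mk' ℂ : {v : Fin 3 → ℂ // v ≠ 0} → P2) ⁻¹' affinePart j =
      {v | v.1 j ≠ 0} := by
    ext v
    exact mk_mem_affinePart v.2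
  rw [this]
  exact isOpen_ne_fun ((continuous_apply j).comp continuous_subtype_val) continuous_const

theorem continuousOn_coordRatio (i j : Fin 3) : ContinuousOn (coordRatio i j) (affinePart j) := by
  rw [isQuotientMap_mk'.continuousOn_isOpen_iff (isOpen_affinePart j)]
  exact ContinuousOn.div ((continuous_apply i).comp continuous_subtype_val).continuousOn
    ((continuous_apply j).comp continuous_subtype_val).continuousOn
    fun v hv => (mk_mem_affinePart v.2).1 hv

theorem continuous_projectivization_mk {Y : Type*} [TopologicalSpace Y] {f : Y → Fin 3 → ℂ}
    (hf : Continuous f) (h0 : ∀ y, f y ≠ 0) :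
    Continuous fun y => (Projectivization.mk ℂ (f y) (h0 y) : P2) :=
  isQuotientMap_mk'.continuous.comp (hf.subtype_mk h0)

theorem continuous_flagParam (σ : Equiv.Perm (Fin 3)) : Continuous (flagParam σ) := by
  refine Continuous.subtype_mk (Continuous.prodMk ?_ ?_) _
  · refine continuous_projectivization_mk
      (f := fun u : ℂ × ℂ × ℂ => ![1, u.1, u.2.1] ∘ σ.symm) ?_ _
    refine continuous_pi fun i => ?_
    simp only [Function.comp_apply]
    generalize σ.symm i = k
    fin_cases k <;> simp <;> fun_prop
  · refine continuous_projectivization_mk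
      (f := fun u : ℂ × ℂ × ℂ => ![u.2.2 * u.1 - u.2.1, -u.2.2, 1] ∘ σ.symm) ?_ _
    refine continuous_pi fun i => ?_
    simp only [Function.comp_apply]
    generalize σ.symm i = k
    fin_cases k <;> simp <;> fun_prop

/-- The coordinates of the chart `σ` of `P(TP²)`. -/
def flagCoord (σ : Equiv.Perm (Fin 3)) (w : PTP2) : ℂ × ℂ × ℂ :=
  (coordRatio (σ 1) (σ 0) w.1.1, coordRatio (σ 2) (σ 0) w.1.1, -coordRatio (σ 1) (σ 2) w.1.2)

/-- The domain of the chart `σ` of `P(TP²)`. -/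
def flagDomain (σ : Equiv.Perm (Fin 3)) : Set PTP2 :=
  {w | w.1.1 ∈ affinePart (σ 0) ∧ w.1.2 ∈ affinePart (σ 2)}

theorem isOpen_flagDomain (σ : Equiv.Perm (Fin 3)) : IsOpen (flagDomain σ) :=
  ((isOpen_affinePart _).preimage (continuous_fst.comp continuous_subtype_val)).inter
    ((isOpen_affinePart _).preimage (continuous_snd.comp continuous_subtype_val))

theorem flagParam_mem_flagDomain (σ : Equiv.Perm (Fin 3)) (u : ℂ × ℂ × ℂ) :
    flagParam σ u ∈ flagDomain σ := by
  refine ⟨(mk_mem_affinePart _).2 ?_, (mk_mem_affinePart _).2 ?_⟩ <;> simp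

theorem continuousOn_flagCoord (σ : Equiv.Perm (Fin 3)) :
    ContinuousOn (flagCoord σ) (flagDomain σ) := by
  have h1 : ContinuousOn (fun w : PTP2 => w.1.1) (flagDomain σ) :=
    (continuous_fst.comp continuous_subtype_val).continuousOn
  have h2 : ContinuousOn (fun w : PTP2 => w.1.2) (flagDomain σ) :=
    (continuous_snd.comp continuous_subtype_val).continuousOn
  exact ((continuousOn_coordRatio _ _).comp h1 fun w hw => hw.1).prodMk
    (((continuousOn_coordRatio _ _).comp h1 fun w hw => hw.1).prodMk
      ((continuousOn_coordRatio _ _).comp h2 fun w hw => hw.2).neg)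

theorem flagCoord_flagParam (σ : Equiv.Perm (Fin 3)) (u : ℂ × ℂ × ℂ) :
    flagCoord σ (flagParam σ u) = u := by
  simp [flagCoord, flagParam, planeParam, coordRatio]

theorem flagParam_flagCoord (σ : Equiv.Perm (Fin 3)) {w : PTP2} (hw : w ∈ flagDomain σ) :
    flagParam σ (flagCoord σ w) = w := by
  obtain ⟨⟨z, d⟩, h⟩ := w
  induction z using Projectivization.ind with | h v hv
  induction d using Projectivization.ind with | h a ha
  have h0 : v (σ 0) ≠ 0 := (mk_mem_affinePart hv).1 hw.1
  have h2 : a (σ 2) ≠ 0 := (mk_mem_affinePart ha).1 hw.2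
  -- The incidence relation recovers the coefficient `a (σ 0)`, which the chart coordinates do not
  -- record.
  have hs : v (σ 0) * a (σ 0) + v (σ 1) * a (σ 1) + v (σ 2) * a (σ 2) = 0 := by
    rw [Projectivization.orthogonal_mk] at h
    rw [← h, dotProduct, ← Equiv.sum_comp σ, Fin.sum_univ_three]
  refine Subtype.ext (Prod.ext ?_ ?_)
  · refine (Projectivization.mk_eq_mk_iff' ℂ _ _ _ _).mpr ⟨(v (σ 0))⁻¹, ?_⟩
    rw [Equiv.eq_comp_symm]
    ext i
    fin_cases i <;> simp [h0, div_eq_inv_mul, flagCoord, coordRatio]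
  · refine (Projectivization.mk_eq_mk_iff' ℂ _ _ _ _).mpr ⟨(a (σ 2))⁻¹, ?_⟩
    rw [Equiv.eq_comp_symm]
    ext i
    fin_cases i
    · simp [flagCoord, coordRatio]
      field_simp
      linear_combination hs
    · simp [flagCoord, coordRatio]
      field_simp
    · simp [h2]

/-- Openness comes from the inverse `flagCoord σ`, continuous on an open set. -/
theorem nhds_flagParam_le (σ : Equiv.Perm (Fin 3)) (u : ℂ × ℂ × ℂ) :
    𝓝 (flagParam σ u) ≤ map (flagParam σ) (𝓝 u) := by
  intro A hA
  have hD := (isOpen_flagDomain σ).mem_nhds (flagParam_mem_flagDomain σ u)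
  have hc := ((continuousOn_flagCoord σ).continuousAt hD).tendsto
  rw [flagCoord_flagParam] at hc
  filter_upwards [hD, hc (mem_map.1 hA)] with w hw hwA
  simpa [flagParam_flagCoord σ hw] using hwA

theorem isOpenMap_flagParam (σ : Equiv.Perm (Fin 3)) : IsOpenMap (flagParam σ) :=
  IsOpenMap.of_nhds_le (nhds_flagParam_le σ)

/-! ### Strata of maximal dimension -/

section Strata

variable {E : Type*} [NormedAddCommGroup E] [NormedSpace ℝ E] [FiniteDimensional ℝ E]
variable {X : Type*} [TopologicalSpace X] {K I : Type*}

/-- In a subvariety of pure dimension `d`, the strata of dimension `d` are dense; more precisely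
every point seen in a chart is adherent to one of them. -/
theorem IsStratification.exists_mem_closure {ψ : K → E → X} (hψ : ∀ σ, Continuous (ψ σ))
    (hψ' : ∀ σ, IsOpenMap (ψ σ)) {r : WithTop ℕ∞} (hr : 1 ≤ r) {d : ℕ} {Y : Set X}
    {strata : I → Set X} {dim : I → ℕ} (hY : IsSubvarietyOfDim ψ r d Y)
    (hS : IsStratification ψ r Y strata dim) (σ : K) {u : E} (hu : ψ σ u ∈ Y) :
    ∃ i, dim i = d ∧ u ∈ closure (ψ σ ⁻¹' strata i) := by
  obtain ⟨U, hU, hfin⟩ := hS.locallyFinite _ hu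
  have hUu : ψ σ ⁻¹' U ∈ 𝓝 u := (hψ σ).continuousAt.preimage_mem_nhds hU
  -- By local finiteness the union is finite, so closure commutes with it and a single stratum can
  -- be chosen.
  suffices h : u ∈ closure (⋃ i ∈ {i | (strata i ∩ U).Nonempty ∧ dim i = d}, ψ σ ⁻¹' strata i) by
    rw [(hfin.subset fun i hi => hi.1).closure_biUnion] at h
    obtain ⟨i, hi, h⟩ := mem_iUnion₂.1 h
    exact ⟨i, hi.2, h⟩
  rw [mem_closure_iff_nhds]
  intro W hW
  obtain ⟨W', hW'sub, hW'o, huW'⟩ := mem_nhds_iff.1 (inter_mem hW hUu)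
  obtain ⟨_, ⟨u', hu'W, rfl⟩, hw'⟩ := mem_closure_iff.1 (hY hu) _ (hψ' σ _ hW'o) ⟨u, huW', rfl⟩
  obtain ⟨V, hVsub, hVo, hu'V⟩ := mem_nhds_iff.1
    (inter_mem (hW'o.mem_nhds hu'W) (hw'.2 σ u' rfl).eventually)
  have hVfin : {i | (ψ σ ⁻¹' strata i ∩ V).Nonempty}.Finite :=
    hfin.subset fun i ⟨y, hyi, hyV⟩ => ⟨ψ σ y, hyi, (hW'sub (hVsub hyV).1).2⟩
  have hVne : {i | (ψ σ ⁻¹' strata i ∩ V).Nonempty}.Nonempty := by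
    have := hw'.1
    rw [← hS.iUnion_eq] at this
    obtain ⟨i, hi⟩ := mem_iUnion.1 this
    exact ⟨i, u', hi, hu'V⟩
  -- Near a point of a stratum of largest dimension among those meeting `V`, no other stratum
  -- accumulates, by the frontier condition. There `Y` coincides with that stratum, and comparing
  -- tangent spaces gives its dimension.
  obtain ⟨k, ⟨y, hyk, hyV⟩, hmax⟩ := exists_max_image _ dim hVfin hVne
  have hyY : ψ σ y ∈ Y := hS.iUnion_eq ▸ mem_iUnion_of_mem k hyk
  have hlocal : ∀ᶠ x in 𝓝 y, x ∈ ψ σ ⁻¹' Y ↔ x ∈ ψ σ ⁻¹' strata k := by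
    have hne : ∀ i ∈ {i | (ψ σ ⁻¹' strata i ∩ V).Nonempty}, ∀ᶠ x in 𝓝 y,
        i ≠ k → ψ σ x ∉ strata i := by
      intro i hi
      by_cases hik : i = k
      · exact Eventually.of_forall fun _ h => absurd hik h
      have hyi : ψ σ y ∉ closure (strata i) := fun h =>
        absurd (hS.frontier k i (Ne.symm hik) ⟨_, hyk, h⟩) (hmax i hi).not_gt
      filter_upwards [(hψ σ).continuousAt.preimage_mem_nhds
        (isClosed_closure.isOpen_compl.mem_nhds hyi)] with x hx _ hxi using
        hx (subset_closure hxi)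
    filter_upwards [(hVfin.eventually_all).2 hne, hVo.mem_nhds hyV] with x hx hxV
    refine ⟨fun hxY => ?_, fun h => hS.iUnion_eq ▸ mem_iUnion_of_mem k h⟩
    rw [mem_preimage, ← hS.iUnion_eq] at hxY
    obtain ⟨i, hi⟩ := mem_iUnion.1 hxY
    by_cases hik : i = k
    · exact hik ▸ hi
    · exact absurd hi (hx i ⟨x, hi, hxV⟩ hik)
  have hdim : dim k = d := by
    rw [← ((hS.submanifold k _ hyk).2 σ y rfl).finrank_tangent hr hyk, ← tangent_congr hlocal]
    exact (hVsub hyV).2.finrank_tangent hr hyY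
  have hyWU := hW'sub (hVsub hyV).1
  exact ⟨y, hyWU.1, mem_iUnion₂.2 ⟨k, ⟨⟨_, hyk, hyWU.2⟩, hdim⟩, hyk⟩⟩

end Strata

/-! ### Passage to the limit along a stratum of dimension 3. -/

theorem continuous_projLin : Continuous projLin :=
  continuous_fst.prodMk (continuous_fst.comp continuous_snd)

end SemiLegendrian

end

open SemiLegendrian
theorem mainTheorem4
    {I J : Type*} (r : WithTop ℕ∞) (hr : 1 ≤ r)
    (M : Set PTP2) (hM : IsSubvarietyOfDim flagParam 2 3 M)
    (hN : IsSubvariety planeParam r (projP '' M))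
    (Ms : I → Set PTP2) (dimM : I → ℕ) (hMs : IsStratification flagParam 2 M Ms dimM)
    (Ns : J → Set P2) (dimN : J → ℕ) (hNs : IsStratification planeParam r (projP '' M) Ns dimN)
    (hleg : ∀ i, dimM i = 3 → IsSemiLegendrian 3 (Ms i))
    (hC : ConditionC planeParam Ns)
    (hsub : ∀ i, ∃ j, IsSubmersionOn (Ms i) (Ns j)) :
    M ⊆ ⋃ j, pStar (Ns j) := by
  intro w hw
  have hz : projP w ∈ ⋃ j, Ns j := hNs.iUnion_eq ▸ mem_image_of_mem projP hw
  obtain ⟨j, hj⟩ := mem_iUnion.1 hz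
  refine mem_iUnion_of_mem j ⟨hj, ?_⟩
  rintro σ v rfl
  have h12 : (1 : WithTop ℕ∞) ≤ 2 := by norm_num
  obtain ⟨i, hi, hv⟩ := hMs.exists_mem_closure continuous_flagParam isOpenMap_flagParam h12 hM σ hw
  obtain ⟨j', hmaps, hsubm⟩ := hsub i
  have hj : projLin v ∈ planeParam σ ⁻¹' Ns j := hj
  have hsmooth := (hNs.submanifold j _ hj).2 σ (projLin v) rfl
  obtain ⟨Φ, V, -, hvΦ, hΦ⟩ := hsmooth.exists_isStraightening hr
  have hO : projLin ⁻¹' Φ.source ∈ 𝓝 v :=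
    continuous_projLin.continuousAt.preimage_mem_nhds (Φ.open_source.mem_nhds hvΦ)
  -- The approximating points are taken over the domain of `Φ`, as the case `j = j'` requires.
  have hv' : v ∈ closure (flagParam σ ⁻¹' Ms i ∩ projLin ⁻¹' Φ.source) := by
    rw [mem_closure_iff_nhdsWithin_neBot, nhdsWithin_inter_of_mem' (mem_nhdsWithin_of_mem_nhds hO)]
    exact mem_closure_iff_nhdsWithin_neBot.1 hv
  obtain ⟨u, hu, huv⟩ := mem_closure_iff_seq_limit.1 hv'
  have hpu : Tendsto (fun n => projLin (u n)) atTop (𝓝 (projLin v)) :=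
    (continuous_projLin.tendsto v).comp huv
  have hl : Tendsto (fun n => (u n).2.2) atTop (𝓝 v.2.2) :=
    ((continuous_snd.comp continuous_snd).tendsto v).comp huv
  have hmem : ∀ n, planeParam σ (projLin (u n)) ∈ Ns j' := fun n => hmaps (hu n).1
  have hne : ∀ n, slopeLine (u n).2.2 ⊔ tangent (planeParam σ ⁻¹' Ns j') (projLin (u n)) ≠ ⊤ := by
    intro n
    have hun : flagParam σ (u n) ∈ Ms i := (hu n).1
    have hsm := hMs.submanifold i _ hun
    rw [hi] at hsm
    rw [← hsubm σ (u n) hun]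
    exact slopeLine_sup_map_ne_top ((hsm.2 σ _ rfl).finrank_tangent h12 hun)
      ((hleg i hi).2.2 _ ⟨hun, fun τ t ht => (hsm.2 τ t ht).of_le h12⟩ σ (u n) rfl)
  -- Condition (C) only concerns distinct strata.
  by_cases hjj : j = j'
  · subst hjj
    exact slopeLine_sup_ne_top_of_tendsto hl
      (hΦ.subspaceTendsto_tangent (fun n => (hu n).2) hvΦ hmem hj hpu) hne
  · obtain ⟨L, hL, hle⟩ := hC j j' hjj σ _ _ hmem hj hpu
    exact fun htop => slopeLine_sup_ne_top_of_tendsto hl hL hne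
      (top_le_iff.1 (htop ▸ sup_le_sup_left hle _))
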